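/- **Setting.** Fix finite sets $\mathcal{L}_V$, $\mathcal{L}_E$ of node and edge labels. A *graph* is a finite directed multigraph $G=(V,E,s,t)$ with total labelling functions $V\to\mathcal{L}_V$, $E\to\mathcal{L}_E$. *Morphisms* are pairs of maps on nodes and edges preserving sources, targets and labels; an *abstract graph* $[G]$ is an isomorphism class of graphs. A *rule* $r=\langle L\leftarrow K\rightarrow R\rangle$ consists of graphs $L,K,R$ (all totally labelled) with inclusions $K\hookrightarrow L$, $K\hookrightarrow R$. A *match* of $r$ in $G$ is an injective morphism $g:L\to G$ satisfying the dangling condition: no edge of $G$ outside $g(L)$ is incident to a node in $g(L\setminus K)$. A *direct derivation* $G\Rightarrow_{r,g}M$ deletes $g(L\setminus K)$ from $G$ and then adds $R\setminus K$ disjointly (edges of $R\setminus K$ being attached to the images of nodes of $K$ as in $R$), where $M$ is any graph isomorphic to the result; its *track* $tr_{G\Rightarrow M}$ is the partial map sending each node of $G$ that is not deleted to the corresponding node of $M$. A *GT system* $T=(\mathcal{L},\mathcal{R})$ is a label alphabet with a finite set $\mathcal{R}$ of rules. Write $G\Rightarrow_{\mathcal R}M$ for a direct derivation using a rule of $\mathcal{R}$,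 and $G\Rightarrow_{\mathcal R}^*M$ if $G\cong M$ or $M$ is obtained from $G$ by one or more direct derivations; the track of $G\Rightarrow_{\mathcal R}^*M$ is the composite of the tracks of its steps (for $G\cong M$, the chosen isomorphism). Graphs $H_1,H_2$ are *joinable* if $H_1\Rightarrow_{\mathcal R}^*M\Leftarrow_{\mathcal R}^*H_2$ for some graph $M$. A pair of direct derivations $\Phi: H_1\Leftarrow_{r_1,g_1}G\Rightarrow_{r_2,g_2}H_2$ with $r_1,r_2\in\mathcal{R}$ is a *critical pair* if $G=g_1(L_1)\cup g_2(L_2)$, the inclusion $g_1(L_1)\cap g_2(L_2)\subseteq g_1(K_1)\cap g_2(K_2)$ (on nodes and edges) fails, and $g_1\neq g_2$ in case $r_1=r_2$. It is *strongly joinable* if there are a graph $M$ and derivations $H_1\Rightarrow_{\mathcal R}^*M\Leftarrow_{\mathcal R}^*H_2$ such that every node $v$ of $G$ which is deleted by neither step of $\Phi$ satisfies $$tr_{G\Rightarrow H_1\Rightarrow^*M}(\{v\})=tr_{G\Rightarrow H_2\Rightarrow^*M}(\{v\})\neq\emptyset .$$ Let $D$ be a set of abstract graphs over $\mathcal{L}$.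 Its *subgraph closure* $\overline{D}$ is the smallest set of abstract graphs that contains $D$ and contains $[H]$ whenever it contains $[G]$ and $H$ is a subgraph of $G$. A critical pair $H_1\Leftarrow G\Rightarrow H_2$ is *non-garbage* if $[G]\in\overline{D}$. The system $T$ is *locally confluent modulo garbage with respect to $D$* if for all graphs $G,H_1,H_2$ with $[G]\in D$ and $H_1\Leftarrow_{\mathcal R}G\Rightarrow_{\mathcal R}H_2$, the graphs $H_1$ and $H_2$ are joinable. **Theorem (Non-Garbage Critical Pair Lemma).** Let $T=(\mathcal{L},\mathcal{R})$ be a GT system and $D$ a set of abstract graphs over $\mathcal{L}$. If all non-garbage critical pairs of $T$ are strongly joinable, then $T$ is locally confluent modulo garbage with respect to $D$. -/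

import Mathlib

universe u v w

namespace GraphTransformation

/-- A finite directed multigraph, totally labelled over the label alphabet `(LV, LE)`. -/
structure Graph (LV : Type v) (LE : Type w) : Type (max (u + 1) v w) where
  V : Type u
  E : Type u
  finV : Finite V
  finE : Finite E
  src : E → V
  tgt : E → V
  nodeLabel : V → LV
  edgeLabel : E → LE

variable {LV : Type v} {LE : Type w}

/-- Graph morphisms preserve sources, targets and labels. -/
structure Hom (G H : Graph.{u} LV LE) where
  onV : G.V → H.V
  onE : G.E → H.E
  src_comm : ∀ e, onV (G.src e) = H.src (onE e)
  tgt_comm : ∀ e, onV (G.tgt e) = H.tgt (onE e)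
  edge_comm : ∀ e, G.edgeLabel e = H.edgeLabel (onE e)
  node_comm : ∀ x, G.nodeLabel x = H.nodeLabel (onV x)

/-- A morphism is injective iff both of its components are. -/
def Hom.Injective {G H : Graph.{u} LV LE} (f : Hom G H) : Prop :=
  Function.Injective f.onV ∧ Function.Injective f.onE

/-- Graph isomorphisms: bijective on nodes and on edges, preserving all the structure
(the inverse maps then preserve it as well). -/
structure Iso (G H : Graph.{u} LV LE) where
  onV : G.V ≃ H.V
  onE : G.E ≃ H.E
  src_comm : ∀ e, onV (G.src e) = H.src (onE e)
  tgt_comm : ∀ e, onV (G.tgt e) = H.tgt (onE e)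
  edge_comm : ∀ e, G.edgeLabel e = H.edgeLabel (onE e)
  node_comm : ∀ x, G.nodeLabel x = H.nodeLabel (onV x)

/-- The identity isomorphism. -/
def Iso.refl (G : Graph.{u} LV LE) : Iso G G where
  onV := Equiv.refl _
  onE := Equiv.refl _
  src_comm _ := rfl
  tgt_comm _ := rfl
  edge_comm _ := rfl
  node_comm _ := rfl

/-- The inverse of an isomorphism. -/
def Iso.symm {G H : Graph.{u} LV LE} (f : Iso G H) : Iso H G where
  onV := f.onV.symm
  onE := f.onE.symm
  src_comm e := by rw [Equiv.symm_apply_eq, f.src_comm, Equiv.apply_symm_apply]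
  tgt_comm e := by rw [Equiv.symm_apply_eq, f.tgt_comm, Equiv.apply_symm_apply]
  edge_comm e := by rw [f.edge_comm, Equiv.apply_symm_apply]
  node_comm x := by rw [f.node_comm, Equiv.apply_symm_apply]

/-- The composite of two isomorphisms. -/
def Iso.trans {G H M : Graph.{u} LV LE} (f : Iso G H) (g : Iso H M) : Iso G M where
  onV := f.onV.trans g.onV
  onE := f.onE.trans g.onE
  src_comm e := by simp [f.src_comm, g.src_comm]
  tgt_comm e := by simp [f.tgt_comm, g.tgt_comm]
  edge_comm e := by simp [f.edge_comm, g.edge_comm]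
  node_comm x := by simp [f.node_comm, g.node_comm]

/-- Isomorphism of graphs as an equivalence relation. -/
def isoSetoid (LV : Type v) (LE : Type w) : Setoid (Graph.{u} LV LE) where
  r G H := Nonempty (Iso G H)
  iseqv :=
    { refl := fun G => ⟨Iso.refl G⟩
      symm := fun ⟨f⟩ => ⟨f.symm⟩
      trans := fun ⟨f⟩ ⟨g⟩ => ⟨f.trans g⟩ }

/-- Abstract graphs: isomorphism classes of totally labelled graphs. -/
def AbstractGraph (LV : Type v) (LE : Type w) : Type (max (u + 1) v w) :=
  Quotient (isoSetoid.{u} LV LE)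

/-- The isomorphism class `[G]`. -/
def Graph.abs (G : Graph.{u} LV LE) : AbstractGraph.{u} LV LE :=
  Quotient.mk (isoSetoid.{u} LV LE) G

/-- `H` is (up to the names of its items) a subgraph of `G`: there is an inclusion, that is, an
injective structure- and label-preserving map. -/
def IsSubgraph (H G : Graph.{u} LV LE) : Prop :=
  ∃ i : Hom H G, i.Injective

/-- A set of abstract graphs is subgraph closed iff it contains, with each graph, all
its subgraphs. -/
def SubgraphClosed (D : Set (AbstractGraph.{u} LV LE)) : Prop :=
  ∀ G H : Graph.{u} LV LE, IsSubgraph H G → G.abs ∈ D → H.abs ∈ D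

/-- The subgraph closure: the smallest subgraph closed set containing `D`. -/
def subgraphClosure (D : Set (AbstractGraph.{u} LV LE)) : Set (AbstractGraph.{u} LV LE) :=
  ⋂₀ {S | D ⊆ S ∧ SubgraphClosed S}

/-- A rule `⟨L ← K → R⟩` of totally labelled graphs; `K` is included in `L` by `inL` and
in `R` by `inR`. -/
structure Rule (LV : Type v) (LE : Type w) : Type (max (u + 1) v w) where
  L : Graph.{u} LV LE
  K : Graph.{u} LV LE
  R : Graph.{u} LV LE
  inL : Hom K L
  inR : Hom K R
  inL_injective : inL.Injective
  inR_injective : inR.Injective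

/-- No edge of `G` outside `g(L)` is incident to a node in `g(L \ K)`. -/
def DanglingCondition (r : Rule.{u} LV LE) (G : Graph.{u} LV LE) (g : Hom r.L G) : Prop :=
  ∀ e : G.E, e ∉ Set.range g.onE →
    ∀ x : r.L.V, x ∉ Set.range r.inL.onV → G.src e ≠ g.onV x ∧ G.tgt e ≠ g.onV x

/-- A match for `r` in `G`: an injective morphism `L → G` satisfying the dangling condition. -/
structure Match (r : Rule.{u} LV LE) (G : Graph.{u} LV LE) where
  hom : Hom r.L G
  injective : hom.Injective
  dangling : DanglingCondition r G hom

namespace Match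

variable {r : Rule.{u} LV LE} {G : Graph.{u} LV LE} (m : Match r G)

/-- The nodes of `G` that survive the deletion of `g(L \ K)`. -/
def KeptV (y : G.V) : Prop := y ∉ m.hom.onV '' (Set.range r.inL.onV)ᶜ

/-- The edges of `G` that survive the deletion of `g(L \ K)`. -/
def KeptE (e : G.E) : Prop := e ∉ m.hom.onE '' (Set.range r.inL.onE)ᶜ

theorem keptV_interface (k : r.K.V) : m.KeptV (m.hom.onV (r.inL.onV k)) := by
  rintro ⟨x, hx, hxk⟩
  exact hx ⟨k, (m.injective.1 hxk).symm⟩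

theorem keptV_src {e : G.E} (he : m.KeptE e) : m.KeptV (G.src e) := by
  rintro ⟨x, hx, hxe⟩
  by_cases h : e ∈ Set.range m.hom.onE
  · obtain ⟨f, rfl⟩ := h
    by_cases hf : f ∈ Set.range r.inL.onE
    · obtain ⟨k, rfl⟩ := hf
      rw [← m.hom.src_comm, ← r.inL.src_comm] at hxe
      exact hx ⟨_, (m.injective.1 hxe).symm⟩
    · exact he ⟨f, hf, rfl⟩
  · exact (m.dangling e h x hx).1 hxe.symm

theorem keptV_tgt {e : G.E} (he : m.KeptE e) : m.KeptV (G.tgt e) := by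
  rintro ⟨x, hx, hxe⟩
  by_cases h : e ∈ Set.range m.hom.onE
  · obtain ⟨f, rfl⟩ := h
    by_cases hf : f ∈ Set.range r.inL.onE
    · obtain ⟨k, rfl⟩ := hf
      rw [← m.hom.tgt_comm, ← r.inL.tgt_comm] at hxe
      exact hx ⟨_, (m.injective.1 hxe).symm⟩
    · exact he ⟨f, hf, rfl⟩
  · exact (m.dangling e h x hx).2 hxe.symm

/-- The intermediate graph: `G` with `g(L \ K)` deleted. -/
def intermediate : Graph.{u} LV LE where
  V := {y : G.V // m.KeptV y}
  E := {e : G.E // m.KeptE e}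
  finV := haveI := G.finV; inferInstance
  finE := haveI := G.finE; inferInstance
  src e := ⟨G.src e.1, m.keptV_src e.2⟩
  tgt e := ⟨G.tgt e.1, m.keptV_tgt e.2⟩
  nodeLabel y := G.nodeLabel y.1
  edgeLabel e := G.edgeLabel e.1

open Classical in
/-- Where a node of `R` goes in the result graph: a node of the interface `K` is identified with
its image under the match, and a node of `R \ K` is a new node. -/
noncomputable def comatchV (x : r.R.V) :
    m.intermediate.V ⊕ {x : r.R.V // x ∉ Set.range r.inR.onV} :=
  if h : x ∈ Set.range r.inR.onV then
    Sum.inl ⟨m.hom.onV (r.inL.onV h.choose), m.keptV_interface h.choose⟩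
  else Sum.inr ⟨x, h⟩

/-- The result graph: `R \ K` is added disjointly to the intermediate graph. -/
noncomputable def result : Graph.{u} LV LE where
  V := m.intermediate.V ⊕ {x : r.R.V // x ∉ Set.range r.inR.onV}
  E := m.intermediate.E ⊕ {e : r.R.E // e ∉ Set.range r.inR.onE}
  finV := haveI := m.intermediate.finV; haveI := r.R.finV; inferInstance
  finE := haveI := m.intermediate.finE; haveI := r.R.finE; inferInstance
  src := Sum.elim (fun e => Sum.inl (m.intermediate.src e)) (fun e => m.comatchV (r.R.src e.1))
  tgt := Sum.elim (fun e => Sum.inl (m.intermediate.tgt e)) (fun e => m.comatchV (r.R.tgt e.1))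
  nodeLabel := Sum.elim m.intermediate.nodeLabel (fun x => r.R.nodeLabel x.1)
  edgeLabel := Sum.elim m.intermediate.edgeLabel (fun e => r.R.edgeLabel e.1)

end Match

/-- A graph transformation system over `(LV, LE)`: a finite set of rules. -/
structure GTSystem (LV : Type v) (LE : Type w) : Type (max (u + 1) v w) where
  rules : Set (Rule.{u} LV LE)
  finite_rules : rules.Finite

/-- A direct derivation `G ⇒ M` of the system: a rule, a match, and an isomorphism from the
result of the rule application to `M`. -/
structure DirectDerivation (T : GTSystem.{u} LV LE) (G M : Graph.{u} LV LE) where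
  rule : Rule.{u} LV LE
  mem : rule ∈ T.rules
  mtch : Match rule G
  iso : Iso mtch.result M

/-- The track morphism of `G ⇒ M` on nodes: a partial function defined on the nodes that are
not deleted, sending each of them to the corresponding node of `M`. -/
def DirectDerivation.track {T : GTSystem.{u} LV LE} {G M : Graph.{u} LV LE}
    (d : DirectDerivation T G M) : G.V →. M.V :=
  fun y => ⟨d.mtch.KeptV y, fun h => d.iso.onV (Sum.inl ⟨y, h⟩)⟩

/-- Derivations `G ⇒* M`: a sequence of zero or more direct derivations, graphs being taken up to
isomorphism. -/
inductive Derivation (T : GTSystem.{u} LV LE) :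
    Graph.{u} LV LE → Graph.{u} LV LE → Type (max (u + 1) v w)
  | iso {G M : Graph.{u} LV LE} (f : Iso G M) : Derivation T G M
  | cons {G H M : Graph.{u} LV LE} (d : DirectDerivation T G H) (s : Derivation T H M) :
      Derivation T G M

/-- The track morphism of `G ⇒* M` on nodes: the composite of the tracks of its steps. -/
def Derivation.track {T : GTSystem.{u} LV LE} {G M : Graph.{u} LV LE} :
    Derivation T G M → (G.V →. M.V)
  | .iso f => fun y => Part.some (f.onV y)
  | .cons d s => s.track.comp d.track

/-- `H₁` and `H₂` are joinable: `H₁ ⇒* M ⇐* H₂` for some graph `M`. -/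
def Joinable (T : GTSystem.{u} LV LE) (H₁ H₂ : Graph.{u} LV LE) : Prop :=
  ∃ M : Graph.{u} LV LE, Nonempty (Derivation T H₁ M) ∧ Nonempty (Derivation T H₂ M)

/-- `T` is locally confluent modulo garbage with respect to `D`. -/
def LocallyConfluentModuloGarbage (T : GTSystem.{u} LV LE)
    (D : Set (AbstractGraph.{u} LV LE)) : Prop :=
  ∀ G H₁ H₂ : Graph.{u} LV LE, G.abs ∈ D →
    Nonempty (DirectDerivation T G H₁) → Nonempty (DirectDerivation T G H₂) → Joinable T H₁ H₂

section CriticalPairs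

variable {T : GTSystem.{u} LV LE} {G H₁ H₂ : Graph.{u} LV LE}

/-- Parallel independence: `g₁(L₁) ∩ g₂(L₂) ⊆ g₁(K₁) ∩ g₂(K₂)`, for nodes and for edges. -/
def ParallelIndependent (d₁ : DirectDerivation T G H₁) (d₂ : DirectDerivation T G H₂) : Prop :=
  (Set.range d₁.mtch.hom.onV ∩ Set.range d₂.mtch.hom.onV ⊆
    d₁.mtch.hom.onV '' Set.range d₁.rule.inL.onV ∩
      d₂.mtch.hom.onV '' Set.range d₂.rule.inL.onV) ∧
  (Set.range d₁.mtch.hom.onE ∩ Set.range d₂.mtch.hom.onE ⊆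
    d₁.mtch.hom.onE '' Set.range d₁.rule.inL.onE ∩
      d₂.mtch.hom.onE '' Set.range d₂.rule.inL.onE)

/-- Critical pairs `H₁ ⇐ G ⇒ H₂`: `G = g₁(L₁) ∪ g₂(L₂)`, the steps are not parallelly
independent, and if the rules are equal then the matches are not. -/
structure IsCriticalPair (d₁ : DirectDerivation T G H₁) (d₂ : DirectDerivation T G H₂) :
    Prop where
  coverV : Set.range d₁.mtch.hom.onV ∪ Set.range d₂.mtch.hom.onV = Set.univ
  coverE : Set.range d₁.mtch.hom.onE ∪ Set.range d₂.mtch.hom.onE = Set.univ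
  dependent : ¬ ParallelIndependent d₁ d₂
  distinct : (⟨d₁.rule, d₁.mtch⟩ : Σ r : Rule.{u} LV LE, Match r G) ≠ ⟨d₂.rule, d₂.mtch⟩

/-- The persistent nodes: those preserved by both steps. -/
def persist (d₁ : DirectDerivation T G H₁) (d₂ : DirectDerivation T G H₂) : Set G.V :=
  {y | (d₁.track.image {y}).Nonempty ∧ (d₂.track.image {y}).Nonempty}

/-- Strong joinability: there are derivations `H₁ ⇒* M ⇐* H₂` such that each persistent node is
preserved by both `G ⇒ H₁ ⇒* M` and `G ⇒ H₂ ⇒* M`, with the same descendant in `M`. -/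
def StronglyJoinable (d₁ : DirectDerivation T G H₁) (d₂ : DirectDerivation T G H₂) : Prop :=
  ∃ (M : Graph.{u} LV LE) (s₁ : Derivation T H₁ M) (s₂ : Derivation T H₂ M),
    ∀ y ∈ persist d₁ d₂,
      (Derivation.cons d₁ s₁).track.image {y} = (Derivation.cons d₂ s₂).track.image {y} ∧
      (Derivation.cons d₁ s₁).track.image {y} ≠ ∅

end CriticalPairs

end GraphTransformation

/-!
The critical pair lemma modulo garbage, by a case distinction on two direct derivations
`H₁ ⇐ G ⇒ H₂` with `[G] ∈ D`.

* If they use the same rule and match, then `H₁ ≅ H₂`.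
* If they are parallelly independent, each match survives the other step, and applying the two
  rules in either order gives the same graph up to isomorphism (`Match.residualResultIso`).
* Otherwise, let `P` be the subgraph `g₁(L₁) ∪ g₂(L₂)` of `G`. Both matches restrict to `P`, which
  gives a critical pair `P₁ ⇐ P ⇒ P₂`, and `[P]` lies in the subgraph closure of `D` because `[G]`
  lies in `D`. So there are derivations `P₁ ⇒* M ⇐* P₂` as in the definition of strong joinability.
  The graph `G` is `P` with a context glued on (`Graph.glueSubgraphIso`): further nodes, and further
  edges whose endpoints are further nodes or nodes of `P`. By the dangling condition, the nodes of
  `P` to which a context edge is attached are deleted by neither step, so both derivations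
  `P ⇒ Pᵢ ⇒* M` preserve them, with the same descendants in `M`. A derivation which preserves all
  the attachment nodes can be carried out with the context in place, the context edges being moved
  along the track (`DirectDerivation.glueResultIso` for one step, `Derivation.glue` in general).
  Hence `H₁` and `H₂` both derive `M` with the context glued on, and since the attachment nodes have
  the same descendants on both sides, this is one and the same graph.
-/

namespace GraphTransformation

variable {LV : Type v} {LE : Type w}

/-! ### Transport along isomorphisms -/

namespace Match

variable {r : Rule.{u} LV LE} {G : Graph.{u} LV LE} (m : Match r G)

theorem keptV_iff {y : G.V} :
    m.KeptV y ↔ ∀ x, m.hom.onV x = y → x ∈ Set.range r.inL.onV :=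
  ⟨fun h x hx => by_contra fun hn => h ⟨x, hn, hx⟩, fun h ⟨x, hn, hx⟩ => hn (h x hx)⟩

theorem keptE_iff {e : G.E} :
    m.KeptE e ↔ ∀ x, m.hom.onE x = e → x ∈ Set.range r.inL.onE :=
  ⟨fun h x hx => by_contra fun hn => h ⟨x, hn, hx⟩, fun h ⟨x, hn, hx⟩ => hn (h x hx)⟩

theorem comatchV_inR (k : r.K.V) :
    m.comatchV (r.inR.onV k) = Sum.inl ⟨m.hom.onV (r.inL.onV k), m.keptV_interface k⟩ := by
  have h : r.inR.onV k ∈ Set.range r.inR.onV := ⟨k, rfl⟩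
  have hk : h.choose = k := r.inR_injective.1 h.choose_spec
  simp only [comatchV, dif_pos h, hk]

theorem comatchV_of_notMem {x : r.R.V} (h : x ∉ Set.range r.inR.onV) :
    m.comatchV x = Sum.inr ⟨x, h⟩ := by
  simp only [comatchV, dif_neg h]

@[ext]
theorem ext {m m' : Match r G} (hV : ∀ x, m.hom.onV x = m'.hom.onV x)
    (hE : ∀ e, m.hom.onE e = m'.hom.onE e) : m = m' := by
  obtain ⟨⟨a, b, _, _, _, _⟩, _, _⟩ := m
  obtain ⟨⟨a', b', _, _, _, _⟩, _, _⟩ := m'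
  obtain rfl : a = a' := funext hV
  obtain rfl : b = b' := funext hE
  rfl

/-- The match obtained by following a match with an isomorphism. -/
def map {G' : Graph.{u} LV LE} (φ : Iso G G') : Match r G' where
  hom :=
    { onV := fun x => φ.onV (m.hom.onV x)
      onE := fun e => φ.onE (m.hom.onE e)
      src_comm := fun e => by rw [m.hom.src_comm, φ.src_comm]
      tgt_comm := fun e => by rw [m.hom.tgt_comm, φ.tgt_comm]
      edge_comm := fun e => by rw [m.hom.edge_comm, φ.edge_comm]
      node_comm := fun x => by rw [m.hom.node_comm, φ.node_comm] }
  injective := ⟨φ.onV.injective.comp m.injective.1, φ.onE.injective.comp m.injective.2⟩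
  dangling := by
    intro e he x hx
    obtain ⟨e, rfl⟩ := φ.onE.surjective e
    have := m.dangling e (fun ⟨f, hf⟩ => he ⟨f, congrArg φ.onE hf⟩) x hx
    rw [← φ.src_comm, ← φ.tgt_comm]
    exact ⟨fun h => this.1 (φ.onV.injective h), fun h => this.2 (φ.onV.injective h)⟩

/-- Applying a rule at two matches which correspond under an isomorphism gives isomorphic
results. -/
noncomputable def resultIso {G' : Graph.{u} LV LE} (φ : Iso G G') (m' : Match r G')
    (hV : ∀ x, φ.onV (m.hom.onV x) = m'.hom.onV x)
    (hE : ∀ e, φ.onE (m.hom.onE e) = m'.hom.onE e) : Iso m.result m'.result where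
  onV := (φ.onV.subtypeEquiv fun y => by
    simp only [keptV_iff, ← hV, EmbeddingLike.apply_eq_iff_eq]).sumCongr (Equiv.refl _)
  onE := (φ.onE.subtypeEquiv fun y => by
    simp only [keptE_iff, ← hE, EmbeddingLike.apply_eq_iff_eq]).sumCongr (Equiv.refl _)
  src_comm := by
    rintro (⟨e, he⟩ | ⟨e, he⟩)
    · exact congrArg Sum.inl (Subtype.ext (φ.src_comm e))
    · change Equiv.sumCongr _ _ (m.comatchV (r.R.src e)) = m'.comatchV (r.R.src e)
      by_cases h : r.R.src e ∈ Set.range r.inR.onV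
      · obtain ⟨k, hk⟩ := h
        rw [← hk, comatchV_inR, comatchV_inR]
        exact congrArg Sum.inl (Subtype.ext (hV _))
      · rw [comatchV_of_notMem _ h, comatchV_of_notMem _ h]; rfl
  tgt_comm := by
    rintro (⟨e, he⟩ | ⟨e, he⟩)
    · exact congrArg Sum.inl (Subtype.ext (φ.tgt_comm e))
    · change Equiv.sumCongr _ _ (m.comatchV (r.R.tgt e)) = m'.comatchV (r.R.tgt e)
      by_cases h : r.R.tgt e ∈ Set.range r.inR.onV
      · obtain ⟨k, hk⟩ := h
        rw [← hk, comatchV_inR, comatchV_inR]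
        exact congrArg Sum.inl (Subtype.ext (hV _))
      · rw [comatchV_of_notMem _ h, comatchV_of_notMem _ h]; rfl
  edge_comm := by
    rintro (⟨e, he⟩ | ⟨e, he⟩)
    · exact φ.edge_comm e
    · rfl
  node_comm := by
    rintro (⟨y, hy⟩ | ⟨x, hx⟩)
    · exact φ.node_comm y
    · rfl

end Match

/-- Derivations are taken up to isomorphism of the start graph. -/
noncomputable def Derivation.precomp {T : GTSystem.{u} LV LE} {G G' M : Graph.{u} LV LE}
    (φ : Iso G G') : Derivation T G' M → Derivation T G M
  | .iso f => .iso (φ.trans f)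
  | .cons d s =>
    .cons
      { rule := d.rule
        mem := d.mem
        mtch := d.mtch.map φ.symm
        iso := ((d.mtch.map φ.symm).resultIso φ d.mtch (fun _ => φ.onV.apply_symm_apply _)
          (fun _ => φ.onE.apply_symm_apply _)).trans d.iso } s

/-! ### Parallelly independent steps -/

/-- Selecting by `p₁`, adding `N₁`, selecting by `p₂` and adding `N₂` amounts to doing so in the
opposite order, if the second selection does not affect the items added before. -/
def sumSubtypeSwap {A : Type*} {N₁ N₂ : Type*} {p₁ p₂ : A → Prop}
    {q₂ : {a // p₁ a} ⊕ N₁ → Prop} {q₁ : {a // p₂ a} ⊕ N₂ → Prop}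
    (h₂ : ∀ a, q₂ (Sum.inl a) ↔ p₂ a.1) (h₂' : ∀ n, q₂ (Sum.inr n))
    (h₁ : ∀ a, q₁ (Sum.inl a) ↔ p₁ a.1) (h₁' : ∀ n, q₁ (Sum.inr n)) :
    {z // q₂ z} ⊕ N₂ ≃ {z // q₁ z} ⊕ N₁ where
  toFun
    | Sum.inl ⟨Sum.inl a, h⟩ => Sum.inl ⟨Sum.inl ⟨a.1, (h₂ a).1 h⟩, (h₁ _).2 a.2⟩
    | Sum.inl ⟨Sum.inr n, _⟩ => Sum.inr n
    | Sum.inr n => Sum.inl ⟨Sum.inr n, h₁' n⟩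
  invFun
    | Sum.inl ⟨Sum.inl a, h⟩ => Sum.inl ⟨Sum.inl ⟨a.1, (h₁ a).1 h⟩, (h₂ _).2 a.2⟩
    | Sum.inl ⟨Sum.inr n, _⟩ => Sum.inr n
    | Sum.inr n => Sum.inl ⟨Sum.inr n, h₂' n⟩
  left_inv := by rintro (⟨_ | _, _⟩ | _) <;> rfl
  right_inv := by rintro (⟨_ | _, _⟩ | _) <;> rfl

namespace Match

variable {r₁ r₂ : Rule.{u} LV LE} {G : Graph.{u} LV LE}

/-- Parallel independence of two matches, elementwise: an item of `G` which is in both images comes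
from an item of the interface under either match. -/
structure Independent (m₁ : Match r₁ G) (m₂ : Match r₂ G) : Prop where
  fstV : ∀ x₁ x₂, m₁.hom.onV x₁ = m₂.hom.onV x₂ → x₁ ∈ Set.range r₁.inL.onV
  sndV : ∀ x₁ x₂, m₁.hom.onV x₁ = m₂.hom.onV x₂ → x₂ ∈ Set.range r₂.inL.onV
  fstE : ∀ x₁ x₂, m₁.hom.onE x₁ = m₂.hom.onE x₂ → x₁ ∈ Set.range r₁.inL.onE
  sndE : ∀ x₁ x₂, m₁.hom.onE x₁ = m₂.hom.onE x₂ → x₂ ∈ Set.range r₂.inL.onE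

theorem Independent.symm {m₁ : Match r₁ G} {m₂ : Match r₂ G} (h : Independent m₁ m₂) :
    Independent m₂ m₁ :=
  ⟨fun _ _ e => h.sndV _ _ e.symm, fun _ _ e => h.fstV _ _ e.symm,
    fun _ _ e => h.sndE _ _ e.symm, fun _ _ e => h.fstE _ _ e.symm⟩

variable {m₁ : Match r₁ G} {m₂ : Match r₂ G}

/-- The residual of `m₂` after `m₁`: a match which is independent of another one remains a match
after the other rule has been applied. -/
def residual (h : Independent m₁ m₂) : Match r₂ m₁.result where
  hom :=
    { onV := fun x => Sum.inl ⟨m₂.hom.onV x, m₁.keptV_iff.2 fun _ hx => h.fstV _ _ hx⟩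
      onE := fun e => Sum.inl ⟨m₂.hom.onE e, m₁.keptE_iff.2 fun _ hx => h.fstE _ _ hx⟩
      src_comm := fun e => congrArg Sum.inl (Subtype.ext (m₂.hom.src_comm e))
      tgt_comm := fun e => congrArg Sum.inl (Subtype.ext (m₂.hom.tgt_comm e))
      edge_comm := fun e => m₂.hom.edge_comm e
      node_comm := fun x => m₂.hom.node_comm x }
  injective := ⟨fun _ _ e => m₂.injective.1 (congrArg Subtype.val (Sum.inl.inj e)),
    fun _ _ e => m₂.injective.2 (congrArg Subtype.val (Sum.inl.inj e))⟩
  dangling := by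
    -- An edge created by the first step is attached to old nodes only in the image of `K₁`.
    have key : ∀ (y : r₁.R.V) (x : r₂.L.V) hx', x ∉ Set.range r₂.inL.onV →
        m₁.comatchV y ≠ Sum.inl ⟨m₂.hom.onV x, hx'⟩ := by
      intro y x hx' hx e
      by_cases hy : y ∈ Set.range r₁.inR.onV
      · obtain ⟨k, rfl⟩ := hy
        rw [comatchV_inR] at e
        exact hx (h.sndV _ _ (congrArg Subtype.val (Sum.inl.inj e)))
      · rw [comatchV_of_notMem _ hy] at e
        cases e
    rintro (⟨e, he⟩ | ⟨e, he⟩) hn x hx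
    · have := m₂.dangling e (fun ⟨f, hf⟩ => hn ⟨f, congrArg Sum.inl (Subtype.ext hf)⟩) x hx
      exact ⟨fun e' => this.1 (congrArg Subtype.val (Sum.inl.inj e')),
        fun e' => this.2 (congrArg Subtype.val (Sum.inl.inj e'))⟩
    · exact ⟨key _ _ _ hx, key _ _ _ hx⟩

variable (h : Independent m₁ m₂)

theorem residual_keptV_inl (y : m₁.intermediate.V) :
    (residual h).KeptV (Sum.inl y) ↔ m₂.KeptV y.1 := by
  refine (keptV_iff _).trans (.trans ?_ (keptV_iff _).symm)
  exact forall_congr' fun x => imp_congr_left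
    ⟨fun e => congrArg Subtype.val (Sum.inl.inj e), fun e => congrArg Sum.inl (Subtype.ext e)⟩

theorem residual_keptV_inr (n : {x : r₁.R.V // x ∉ Set.range r₁.inR.onV}) :
    (residual h).KeptV (Sum.inr n) :=
  (keptV_iff _).2 fun _ e => nomatch e

theorem residual_keptE_inl (y : m₁.intermediate.E) :
    (residual h).KeptE (Sum.inl y) ↔ m₂.KeptE y.1 := by
  refine (keptE_iff _).trans (.trans ?_ (keptE_iff _).symm)
  exact forall_congr' fun x => imp_congr_left
    ⟨fun e => congrArg Subtype.val (Sum.inl.inj e), fun e => congrArg Sum.inl (Subtype.ext e)⟩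

theorem residual_keptE_inr (n : {e : r₁.R.E // e ∉ Set.range r₁.inR.onE}) :
    (residual h).KeptE (Sum.inr n) :=
  (keptE_iff _).2 fun _ e => nomatch e

/-- The bijection on nodes underlying `residualResultIso`. -/
def residualEquivV : (residual h).result.V ≃ (residual h.symm).result.V :=
  sumSubtypeSwap (residual_keptV_inl h) (residual_keptV_inr h)
    (residual_keptV_inl h.symm) (residual_keptV_inr h.symm)

/-- The swap sends the copy of a node of `R₁` present after the second step to the copy of it which
the second step creates in the opposite order. -/
theorem residualEquivV_comatchV_fst (y : r₁.R.V) (hy : (residual h).KeptV (m₁.comatchV y)) :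
    residualEquivV h (Sum.inl ⟨m₁.comatchV y, hy⟩) = (residual h.symm).comatchV y := by
  by_cases hr : y ∈ Set.range r₁.inR.onV
  · obtain ⟨k, rfl⟩ := hr
    simp only [comatchV_inR]
    rfl
  · simp only [comatchV_of_notMem _ hr]
    rfl

theorem residualEquivV_comatchV_snd (y : r₂.R.V)
    (hy : (residual h.symm).KeptV (m₂.comatchV y)) :
    residualEquivV h ((residual h).comatchV y) = Sum.inl ⟨m₂.comatchV y, hy⟩ := by
  by_cases hr : y ∈ Set.range r₂.inR.onV
  · obtain ⟨k, rfl⟩ := hr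
    simp only [comatchV_inR]
    rfl
  · simp only [comatchV_of_notMem _ hr]
    rfl

/-- Independent steps commute: applying the two rules in either order gives isomorphic graphs. -/
def residualResultIso : Iso (residual h).result (residual h.symm).result where
  onV := residualEquivV h
  onE := sumSubtypeSwap (residual_keptE_inl h) (residual_keptE_inr h)
    (residual_keptE_inl h.symm) (residual_keptE_inr h.symm)
  src_comm := by
    rintro (⟨e | e, he⟩ | e)
    · rfl
    · exact residualEquivV_comatchV_fst h _ _
    · exact residualEquivV_comatchV_snd h _ _
  tgt_comm := by
    rintro (⟨e | e, he⟩ | e)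
    · rfl
    · exact residualEquivV_comatchV_fst h _ _
    · exact residualEquivV_comatchV_snd h _ _
  edge_comm := by rintro (⟨e | e, he⟩ | e) <;> rfl
  node_comm := by rintro (⟨e | e, he⟩ | e) <;> rfl

end Match

/-! ### Gluing a context to a graph -/

/-- The items of a context: labelled nodes and edges to be added to a graph. The endpoints of the
edges are not part of the structure, since they vary along a derivation. -/
structure Context (LV : Type v) (LE : Type w) : Type (max (u + 1) v w) where
  V : Type u
  E : Type u
  finV : Finite V
  finE : Finite E
  nodeLabel : V → LV
  edgeLabel : E → LE

/-- The graph `P` with the items of `C` added, the edges of `C` having the given sources and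
targets. -/
def Graph.glue (P : Graph.{u} LV LE) (C : Context.{u} LV LE) (s t : C.E → P.V ⊕ C.V) :
    Graph.{u} LV LE where
  V := P.V ⊕ C.V
  E := P.E ⊕ C.E
  finV := haveI := P.finV; haveI := C.finV; inferInstance
  finE := haveI := P.finE; haveI := C.finE; inferInstance
  src := Sum.elim (fun e => Sum.inl (P.src e)) s
  tgt := Sum.elim (fun e => Sum.inl (P.tgt e)) t
  nodeLabel := Sum.elim P.nodeLabel C.nodeLabel
  edgeLabel := Sum.elim P.edgeLabel C.edgeLabel

/-- The endpoint `b` results from the endpoint `a` of a context edge by following the partial map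
`f`; in particular `f` is defined at `a` if `a` is not a node of the context. -/
def Follows {A B X : Type*} (f : A →. B) (a : A ⊕ X) (b : B ⊕ X) : Prop :=
  Sum.LiftRel (fun p q => q ∈ f p) Eq a b

theorem Follows.exists_of_comp {A B C X : Type*} {f : A →. B} {g : B →. C} {a : A ⊕ X}
    {c : C ⊕ X} (h : Follows (g.comp f) a c) : ∃ b, Follows f a b ∧ Follows g b c := by
  cases h with
  | inl h =>
    obtain ⟨b, hb, hc⟩ := Part.mem_bind_iff.1 h
    exact ⟨Sum.inl b, .inl hb, .inl hc⟩
  | inr h => exact ⟨Sum.inr _, .inr rfl, .inr h⟩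

/-- Items added before a selection which does not affect them may be added after it. -/
def subtypeSumSum {A X N : Type*} {p : A → Prop} {q : A ⊕ X → Prop}
    (h : ∀ a, q (Sum.inl a) ↔ p a) (h' : ∀ x, q (Sum.inr x)) :
    {z // q z} ⊕ N ≃ ({a // p a} ⊕ N) ⊕ X where
  toFun
    | Sum.inl ⟨Sum.inl a, ha⟩ => Sum.inl (Sum.inl ⟨a, (h a).1 ha⟩)
    | Sum.inl ⟨Sum.inr x, _⟩ => Sum.inr x
    | Sum.inr n => Sum.inl (Sum.inr n)
  invFun
    | Sum.inl (Sum.inl a) => Sum.inl ⟨Sum.inl a.1, (h _).2 a.2⟩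
    | Sum.inl (Sum.inr n) => Sum.inr n
    | Sum.inr x => Sum.inl ⟨Sum.inr x, h' x⟩
  left_inv := by rintro (⟨_ | _, _⟩ | _) <;> rfl
  right_inv := by rintro ((_ | _) | _) <;> rfl

namespace Match

variable {r : Rule.{u} LV LE} {P : Graph.{u} LV LE} {C : Context.{u} LV LE}
  {s t : C.E → P.V ⊕ C.V} (m : Match r P)

/-- A match in `P` is a match in `P` with a context, if it deletes no node to which a context edge
is attached. -/
def glue (hs : ∀ e y, s e = Sum.inl y → m.KeptV y) (ht : ∀ e y, t e = Sum.inl y → m.KeptV y) :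
    Match r (P.glue C s t) where
  hom :=
    { onV := fun x => Sum.inl (m.hom.onV x)
      onE := fun e => Sum.inl (m.hom.onE e)
      src_comm := fun e => congrArg Sum.inl (m.hom.src_comm e)
      tgt_comm := fun e => congrArg Sum.inl (m.hom.tgt_comm e)
      edge_comm := fun e => m.hom.edge_comm e
      node_comm := fun x => m.hom.node_comm x }
  injective := ⟨Sum.inl_injective.comp m.injective.1, Sum.inl_injective.comp m.injective.2⟩
  dangling := by
    rintro (e | e) hn x hx
    · have := m.dangling e (fun ⟨f, hf⟩ => hn ⟨f, congrArg Sum.inl hf⟩) x hx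
      exact ⟨fun h => this.1 (Sum.inl.inj h), fun h => this.2 (Sum.inl.inj h)⟩
    · exact ⟨fun h => hx (m.keptV_iff.1 (hs e _ h) x rfl),
        fun h => hx (m.keptV_iff.1 (ht e _ h) x rfl)⟩

variable (hs : ∀ e y, s e = Sum.inl y → m.KeptV y) (ht : ∀ e y, t e = Sum.inl y → m.KeptV y)

theorem glue_keptV_inl (y : P.V) : (m.glue hs ht).KeptV (Sum.inl y) ↔ m.KeptV y := by
  refine (keptV_iff _).trans (.trans ?_ (keptV_iff _).symm)
  exact forall_congr' fun x => imp_congr_left ⟨fun e => Sum.inl.inj e, fun e => congrArg Sum.inl e⟩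

theorem glue_keptV_inr (x : C.V) : (m.glue hs ht).KeptV (Sum.inr x) :=
  (keptV_iff _).2 fun _ e => nomatch e

theorem glue_keptE_inl (y : P.E) : (m.glue hs ht).KeptE (Sum.inl y) ↔ m.KeptE y := by
  refine (keptE_iff _).trans (.trans ?_ (keptE_iff _).symm)
  exact forall_congr' fun x => imp_congr_left ⟨fun e => Sum.inl.inj e, fun e => congrArg Sum.inl e⟩

theorem glue_keptE_inr (x : C.E) : (m.glue hs ht).KeptE (Sum.inr x) :=
  (keptE_iff _).2 fun _ e => nomatch e

/-- The bijection on nodes underlying `DirectDerivation.glueResultIso`. -/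
def glueEquivV {P' : Graph.{u} LV LE} (φ : Iso m.result P') :
    (m.glue hs ht).result.V ≃ P'.V ⊕ C.V :=
  (subtypeSumSum (m.glue_keptV_inl hs ht) (m.glue_keptV_inr hs ht)).trans
    (φ.onV.sumCongr (Equiv.refl _))

theorem glueEquivV_comatchV {P' : Graph.{u} LV LE} (φ : Iso m.result P') (y : r.R.V) :
    m.glueEquivV hs ht φ ((m.glue hs ht).comatchV y) = Sum.inl (φ.onV (m.comatchV y)) := by
  by_cases hr : y ∈ Set.range r.inR.onV
  · obtain ⟨k, rfl⟩ := hr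
    simp only [comatchV_inR]
    rfl
  · simp only [comatchV_of_notMem _ hr]
    rfl

end Match

namespace DirectDerivation

variable {T : GTSystem.{u} LV LE} {P P' : Graph.{u} LV LE} {C : Context.{u} LV LE}
  (d : DirectDerivation T P P')

theorem keptV_of_follows {a : C.E → P.V ⊕ C.V} {b : C.E → P'.V ⊕ C.V}
    (h : ∀ e, Follows d.track (a e) (b e)) (e : C.E) (y : P.V) (hy : a e = Sum.inl y) :
    d.mtch.KeptV y := by
  have := h e
  rw [hy] at this
  generalize b e = z at this
  cases this with
  | inl h => exact h.1

variable {s t : C.E → P.V ⊕ C.V} {s' t' : C.E → P'.V ⊕ C.V}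

theorem glueEquivV_of_follows (hs ht) (a : P.V ⊕ C.V) (b : P'.V ⊕ C.V) (h : Follows d.track a b)
    (ha : (d.mtch.glue (C := C) (s := s) (t := t) hs ht).KeptV a) :
    d.mtch.glueEquivV hs ht d.iso (Sum.inl ⟨a, ha⟩) = b := by
  cases h with
  | inl h =>
    obtain ⟨_, rfl⟩ := h
    rfl
  | inr h => exact congrArg Sum.inr h

/-- A direct derivation `P ⇒ P'` that keeps the attachment nodes can be carried out with a context
in place, the endpoints of the context edges following the track. -/
def glueResultIso (hs : ∀ e, Follows d.track (s e) (s' e))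
    (ht : ∀ e, Follows d.track (t e) (t' e)) :
    Iso (d.mtch.glue (d.keptV_of_follows hs) (d.keptV_of_follows ht)).result
      (P'.glue C s' t') where
  onV := d.mtch.glueEquivV _ _ d.iso
  onE := (subtypeSumSum (d.mtch.glue_keptE_inl _ _) (d.mtch.glue_keptE_inr _ _)).trans
    (d.iso.onE.sumCongr (Equiv.refl _))
  src_comm := by
    rintro (⟨e | e, he⟩ | e)
    · exact congrArg Sum.inl (d.iso.src_comm (Sum.inl ⟨e, (d.mtch.glue_keptE_inl _ _ e).1 he⟩))
    · exact d.glueEquivV_of_follows _ _ _ _ (hs e) _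
    · exact (d.mtch.glueEquivV_comatchV _ _ d.iso _).trans
        (congrArg Sum.inl (d.iso.src_comm (Sum.inr e)))
  tgt_comm := by
    rintro (⟨e | e, he⟩ | e)
    · exact congrArg Sum.inl (d.iso.tgt_comm (Sum.inl ⟨e, (d.mtch.glue_keptE_inl _ _ e).1 he⟩))
    · exact d.glueEquivV_of_follows _ _ _ _ (ht e) _
    · exact (d.mtch.glueEquivV_comatchV _ _ d.iso _).trans
        (congrArg Sum.inl (d.iso.tgt_comm (Sum.inr e)))
  edge_comm := by
    rintro (⟨e | e, he⟩ | e)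
    · exact d.iso.edge_comm (Sum.inl ⟨e, (d.mtch.glue_keptE_inl _ _ e).1 he⟩)
    · rfl
    · exact d.iso.edge_comm (Sum.inr e)
  node_comm := by
    rintro (⟨y | y, hy⟩ | x)
    · exact d.iso.node_comm (Sum.inl ⟨y, (d.mtch.glue_keptV_inl _ _ y).1 hy⟩)
    · rfl
    · exact d.iso.node_comm (Sum.inr x)

end DirectDerivation

/-- A derivation that preserves the attachment nodes can be carried out with a context in place. -/
theorem Derivation.glue {T : GTSystem.{u} LV LE} {C : Context.{u} LV LE} {P M : Graph.{u} LV LE}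
    (σ : Derivation T P M) {s t : C.E → P.V ⊕ C.V} {s' t' : C.E → M.V ⊕ C.V}
    (hs : ∀ e, Follows σ.track (s e) (s' e)) (ht : ∀ e, Follows σ.track (t e) (t' e)) :
    Nonempty (Derivation T (P.glue C s t) (M.glue C s' t')) := by
  induction σ with
  | @iso P M f =>
    have key : ∀ a b, Follows (Derivation.iso (T := T) f).track a b →
        Equiv.sumCongr f.onV (Equiv.refl C.V) a = b := by
      intro a b h
      cases h with
      | inl h => exact congrArg Sum.inl (Part.mem_some_iff.1 h).symm
      | inr h => exact congrArg Sum.inr h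
    refine ⟨.iso ⟨f.onV.sumCongr (Equiv.refl _), f.onE.sumCongr (Equiv.refl _), ?_, ?_, ?_, ?_⟩⟩
    · rintro (e | e)
      · exact congrArg Sum.inl (f.src_comm e)
      · exact key _ _ (hs e)
    · rintro (e | e)
      · exact congrArg Sum.inl (f.tgt_comm e)
      · exact key _ _ (ht e)
    · rintro (e | e)
      · exact f.edge_comm e
      · rfl
    · rintro (x | x)
      · exact f.node_comm x
      · rfl
  | cons d σ ih =>
    choose s₁ hs₁ hs₁' using fun e => (hs e).exists_of_comp
    choose t₁ ht₁ ht₁' using fun e => (ht e).exists_of_comp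
    obtain ⟨τ⟩ := ih hs₁' ht₁'
    exact ⟨.cons ⟨d.rule, d.mem, _, d.glueResultIso hs₁ ht₁⟩ τ⟩

/-! ### Decomposing a graph into a subgraph and its context -/

/-- The subgraph of `G` with the given nodes and edges. -/
def Graph.subgraph (G : Graph.{u} LV LE) (A : Set G.V) (B : Set G.E) (hs : ∀ e ∈ B, G.src e ∈ A)
    (ht : ∀ e ∈ B, G.tgt e ∈ A) : Graph.{u} LV LE where
  V := A
  E := B
  finV := haveI := G.finV; inferInstance
  finE := haveI := G.finE; inferInstance
  src e := ⟨G.src e.1, hs e.1 e.2⟩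
  tgt e := ⟨G.tgt e.1, ht e.1 e.2⟩
  nodeLabel x := G.nodeLabel x.1
  edgeLabel e := G.edgeLabel e.1

section Subgraph

variable {G : Graph.{u} LV LE} {A : Set G.V} {B : Set G.E} (hs : ∀ e ∈ B, G.src e ∈ A)
  (ht : ∀ e ∈ B, G.tgt e ∈ A)

theorem Graph.isSubgraph_subgraph : IsSubgraph (G.subgraph A B hs ht) G :=
  ⟨⟨Subtype.val, Subtype.val, fun _ => rfl, fun _ => rfl, fun _ => rfl, fun _ => rfl⟩,
    Subtype.val_injective, Subtype.val_injective⟩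

/-- A match whose image lies in a subgraph, as a match in that subgraph. -/
def Match.restrict {r : Rule.{u} LV LE} (m : Match r G) (hA : ∀ x, m.hom.onV x ∈ A)
    (hB : ∀ e, m.hom.onE e ∈ B) : Match r (G.subgraph A B hs ht) where
  hom :=
    { onV := fun x => ⟨m.hom.onV x, hA x⟩
      onE := fun e => ⟨m.hom.onE e, hB e⟩
      src_comm := fun e => Subtype.ext (m.hom.src_comm e)
      tgt_comm := fun e => Subtype.ext (m.hom.tgt_comm e)
      edge_comm := fun e => m.hom.edge_comm e
      node_comm := fun x => m.hom.node_comm x }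
  injective := ⟨fun _ _ e => m.injective.1 (congrArg Subtype.val e),
    fun _ _ e => m.injective.2 (congrArg Subtype.val e)⟩
  dangling := by
    rintro ⟨e, he⟩ hn x hx
    have := m.dangling e (fun ⟨f, hf⟩ => hn ⟨f, Subtype.ext hf⟩) x hx
    exact ⟨fun h => this.1 (congrArg Subtype.val h), fun h => this.2 (congrArg Subtype.val h)⟩

theorem Match.restrict_keptV_iff {r : Rule.{u} LV LE} (m : Match r G)
    (hA : ∀ x, m.hom.onV x ∈ A) (hB : ∀ e, m.hom.onE e ∈ B) (y : A) :
    (m.restrict hs ht hA hB).KeptV y ↔ m.KeptV y.1 := by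
  refine (keptV_iff _).trans (.trans ?_ (keptV_iff _).symm)
  exact forall_congr' fun x => imp_congr_left
    ⟨fun e => congrArg Subtype.val e, fun e => Subtype.ext e⟩

/-- The items of `G` outside a subgraph. -/
def Graph.context (G : Graph.{u} LV LE) (A : Set G.V) (B : Set G.E) : Context.{u} LV LE where
  V := {x // x ∉ A}
  E := {e // e ∉ B}
  finV := haveI := G.finV; inferInstance
  finE := haveI := G.finE; inferInstance
  nodeLabel x := G.nodeLabel x.1
  edgeLabel e := G.edgeLabel e.1

open Classical in
/-- The node `y` of `G`, as an endpoint in `A` or in the context of `A`. -/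
noncomputable def Graph.split (A : Set G.V) (y : G.V) : A ⊕ {x // x ∉ A} :=
  (Equiv.sumCompl (· ∈ A)).symm y

open Classical in
/-- A graph is obtained from a subgraph by gluing on the rest. -/
noncomputable def Graph.glueSubgraphIso :
    Iso ((G.subgraph A B hs ht).glue (G.context A B) (fun e => Graph.split A (G.src e.1))
      (fun e => Graph.split A (G.tgt e.1))) G where
  onV := Equiv.sumCompl (· ∈ A)
  onE := Equiv.sumCompl (· ∈ B)
  src_comm := by
    rintro (e | e)
    · rfl
    · exact (Equiv.sumCompl (· ∈ A)).apply_symm_apply _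
  tgt_comm := by
    rintro (e | e)
    · rfl
    · exact (Equiv.sumCompl (· ∈ A)).apply_symm_apply _
  edge_comm := by rintro (e | e) <;> rfl
  node_comm := by rintro (e | e) <;> rfl

theorem Graph.val_of_split_eq_inl {y : G.V} {z : A} (h : Graph.split A y = Sum.inl z) :
    z.1 = y := by
  classical
  exact ((Equiv.symm_apply_eq _).1 h).symm

/-- A derivation that starts with a match restricted to a subgraph of `G` and preserves the
attachment nodes of the rest of `G` yields a derivation from the result of the original match. -/
theorem Match.nonempty_derivation_glue {T : GTSystem.{u} LV LE} {r : Rule.{u} LV LE}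
    (hr : r ∈ T.rules) (m : Match r G) (hA : ∀ x, m.hom.onV x ∈ A) (hB : ∀ e, m.hom.onE e ∈ B)
    {P' M : Graph.{u} LV LE} (φ : Iso (m.restrict hs ht hA hB).result P') (σ : Derivation T P' M)
    {s' t' : (G.context A B).E → M.V ⊕ (G.context A B).V}
    (hs' : ∀ e, Follows (Derivation.cons ⟨r, hr, m.restrict hs ht hA hB, φ⟩ σ).track
      (Graph.split A (G.src e.1)) (s' e))
    (ht' : ∀ e, Follows (Derivation.cons ⟨r, hr, m.restrict hs ht hA hB, φ⟩ σ).track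
      (Graph.split A (G.tgt e.1)) (t' e)) :
    Nonempty (Derivation T m.result (M.glue (G.context A B) s' t')) := by
  choose s₁ hs₁ hs₁' using fun e => (hs' e).exists_of_comp
  choose t₁ ht₁ ht₁' using fun e => (ht' e).exists_of_comp
  obtain ⟨τ⟩ := σ.glue hs₁' ht₁'
  let d : DirectDerivation T (G.subgraph A B hs ht) P' := ⟨r, hr, m.restrict hs ht hA hB, φ⟩
  have ψ := Match.resultIso (d.mtch.glue (d.keptV_of_follows hs₁) (d.keptV_of_follows ht₁))
    (Graph.glueSubgraphIso hs ht) m (fun _ => rfl) (fun _ => rfl)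
  exact ⟨τ.precomp (ψ.symm.trans (d.glueResultIso hs₁ ht₁))⟩

end Subgraph

theorem mem_subgraphClosure {D : Set (AbstractGraph.{u} LV LE)} {G H : Graph.{u} LV LE}
    (hG : G.abs ∈ D) (hH : IsSubgraph H G) : H.abs ∈ subgraphClosure D :=
  Set.mem_sInter.2 fun _ hS => hS.2 G H hH (hS.1 hG)

/-! ### Local confluence -/

section Main

variable {T : GTSystem.{u} LV LE} {G : Graph.{u} LV LE} {r₁ r₂ : Rule.{u} LV LE}

theorem Joinable.of_iso {H₁ H₂ H₁' H₂' : Graph.{u} LV LE} (φ₁ : Iso H₁ H₁') (φ₂ : Iso H₂ H₂')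
    (h : Joinable T H₁' H₂') : Joinable T H₁ H₂ :=
  let ⟨M, ⟨σ₁⟩, ⟨σ₂⟩⟩ := h
  ⟨M, ⟨σ₁.precomp φ₁⟩, ⟨σ₂.precomp φ₂⟩⟩

theorem Match.Independent.joinable (hr₁ : r₁ ∈ T.rules) (hr₂ : r₂ ∈ T.rules) {m₁ : Match r₁ G}
    {m₂ : Match r₂ G} (h : m₁.Independent m₂) : Joinable T m₁.result m₂.result :=
  ⟨_, ⟨.cons ⟨r₂, hr₂, residual h, residualResultIso h⟩ (.iso (Iso.refl _))⟩,
    ⟨.cons ⟨r₁, hr₁, residual h.symm, Iso.refl _⟩ (.iso (Iso.refl _))⟩⟩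

theorem Match.Independent.of_parallelIndependent {H₁ H₂ : Graph.{u} LV LE}
    {d₁ : DirectDerivation T G H₁} {d₂ : DirectDerivation T G H₂}
    (h : ParallelIndependent d₁ d₂) : d₁.mtch.Independent d₂.mtch where
  fstV x₁ x₂ e := by
    obtain ⟨_, hk, hx⟩ := (h.1 ⟨⟨x₁, rfl⟩, ⟨x₂, e.symm⟩⟩).1
    exact d₁.mtch.injective.1 hx ▸ hk
  sndV x₁ x₂ e := by
    obtain ⟨_, hk, hx⟩ := (h.1 ⟨⟨x₁, e⟩, ⟨x₂, rfl⟩⟩).2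
    exact d₂.mtch.injective.1 hx ▸ hk
  fstE x₁ x₂ e := by
    obtain ⟨_, hk, hx⟩ := (h.2 ⟨⟨x₁, rfl⟩, ⟨x₂, e.symm⟩⟩).1
    exact d₁.mtch.injective.2 hx ▸ hk
  sndE x₁ x₂ e := by
    obtain ⟨_, hk, hx⟩ := (h.2 ⟨⟨x₁, e⟩, ⟨x₂, rfl⟩⟩).2
    exact d₂.mtch.injective.2 hx ▸ hk

theorem DirectDerivation.image_track_nonempty {H : Graph.{u} LV LE} (d : DirectDerivation T G H)
    {y : G.V} (hy : d.mtch.KeptV y) : (d.track.image {y}).Nonempty :=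
  ⟨_, y, rfl, hy, rfl⟩

/-- The case of two steps that are neither independent nor equal: the critical pair obtained by
restricting them to the union of the images of their matches is strongly joinable, and the joining
derivations extend to the context. -/
theorem joinable_of_not_independent {D : Set (AbstractGraph.{u} LV LE)}
    (h : ∀ (G H₁ H₂ : Graph.{u} LV LE) (d₁ : DirectDerivation T G H₁)
      (d₂ : DirectDerivation T G H₂), IsCriticalPair d₁ d₂ → G.abs ∈ subgraphClosure D →
      StronglyJoinable d₁ d₂)
    (hG : G.abs ∈ D) (hr₁ : r₁ ∈ T.rules) (hr₂ : r₂ ∈ T.rules) (m₁ : Match r₁ G) (m₂ : Match r₂ G)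
    (hdep : ¬ m₁.Independent m₂)
    (hne : (⟨r₁, m₁⟩ : Σ r : Rule.{u} LV LE, Match r G) ≠ ⟨r₂, m₂⟩) :
    Joinable T m₁.result m₂.result := by
  let A : Set G.V := Set.range m₁.hom.onV ∪ Set.range m₂.hom.onV
  let B : Set G.E := Set.range m₁.hom.onE ∪ Set.range m₂.hom.onE
  have hs : ∀ e ∈ B, G.src e ∈ A := by
    rintro _ (⟨e, rfl⟩ | ⟨e, rfl⟩)
    · exact .inl ⟨_, m₁.hom.src_comm e⟩
    · exact .inr ⟨_, m₂.hom.src_comm e⟩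
  have ht : ∀ e ∈ B, G.tgt e ∈ A := by
    rintro _ (⟨e, rfl⟩ | ⟨e, rfl⟩)
    · exact .inl ⟨_, m₁.hom.tgt_comm e⟩
    · exact .inr ⟨_, m₂.hom.tgt_comm e⟩
  have hA₁ : ∀ x, m₁.hom.onV x ∈ A := fun x => .inl ⟨x, rfl⟩
  have hB₁ : ∀ x, m₁.hom.onE x ∈ B := fun x => .inl ⟨x, rfl⟩
  have hA₂ : ∀ x, m₂.hom.onV x ∈ A := fun x => .inr ⟨x, rfl⟩
  have hB₂ : ∀ x, m₂.hom.onE x ∈ B := fun x => .inr ⟨x, rfl⟩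
  let n₁ := m₁.restrict hs ht hA₁ hB₁
  let n₂ := m₂.restrict hs ht hA₂ hB₂
  let d₁ : DirectDerivation T (G.subgraph A B hs ht) n₁.result := ⟨r₁, hr₁, n₁, Iso.refl _⟩
  let d₂ : DirectDerivation T (G.subgraph A B hs ht) n₂.result := ⟨r₂, hr₂, n₂, Iso.refl _⟩
  have hcrit : IsCriticalPair d₁ d₂ :=
    { coverV := by
        refine Set.eq_univ_of_forall ?_
        rintro ⟨_, ⟨x, rfl⟩ | ⟨x, rfl⟩⟩
        · exact .inl ⟨x, rfl⟩
        · exact .inr ⟨x, rfl⟩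
      coverE := by
        refine Set.eq_univ_of_forall ?_
        rintro ⟨_, ⟨x, rfl⟩ | ⟨x, rfl⟩⟩
        · exact .inl ⟨x, rfl⟩
        · exact .inr ⟨x, rfl⟩
      dependent := by
        intro hpar
        have hi := Match.Independent.of_parallelIndependent hpar
        exact hdep ⟨fun _ _ e => hi.fstV _ _ (Subtype.ext e),
          fun _ _ e => hi.sndV _ _ (Subtype.ext e), fun _ _ e => hi.fstE _ _ (Subtype.ext e),
          fun _ _ e => hi.sndE _ _ (Subtype.ext e)⟩
      distinct := by
        intro heq
        obtain ⟨hrr, hmm⟩ := Sigma.mk.inj_iff.1 heq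
        change r₁ = r₂ at hrr
        subst hrr
        have hmm : n₁ = n₂ := eq_of_heq hmm
        refine hne (congrArg _ (Match.ext (fun x => ?_) fun e => ?_))
        · exact congrArg (fun n : Match r₁ (G.subgraph A B hs ht) => (n.hom.onV x).1) hmm
        · exact congrArg (fun n : Match r₁ (G.subgraph A B hs ht) => (n.hom.onE e).1) hmm }
  obtain ⟨M, σ₁, σ₂, hσ⟩ := h _ _ _ d₁ d₂ hcrit
    (mem_subgraphClosure hG (Graph.isSubgraph_subgraph hs ht))
  -- A node that both matches keep has a common descendant in `M`.
  have key : ∀ y : G.V, m₁.KeptV y → m₂.KeptV y → ∃ b,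
      Follows (Derivation.cons d₁ σ₁).track (Graph.split A y) b ∧
      Follows (Derivation.cons d₂ σ₂).track (Graph.split A y) b := by
    intro y hy₁ hy₂
    cases hz : Graph.split A y with
    | inl z =>
      obtain rfl := Graph.val_of_split_eq_inl hz
      have := hσ z ⟨d₁.image_track_nonempty ((m₁.restrict_keptV_iff hs ht hA₁ hB₁ z).2 hy₁),
        d₂.image_track_nonempty ((m₂.restrict_keptV_iff hs ht hA₂ hB₂ z).2 hy₂)⟩
      obtain ⟨b, hb⟩ := Set.nonempty_iff_ne_empty.2 this.2
      have hb₂ := this.1 ▸ hb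
      obtain ⟨_, rfl, hb⟩ := hb
      obtain ⟨_, rfl, hb₂⟩ := hb₂
      exact ⟨Sum.inl b, .inl hb, .inl hb₂⟩
    | inr z => exact ⟨Sum.inr z, .inr rfl, .inr rfl⟩
  -- By the dangling condition, the endpoints of an edge outside `B` are kept by both matches.
  have hE₁ : ∀ e : (G.context A B).E, e.1 ∉ Set.range m₁.hom.onE := fun e he => e.2 (.inl he)
  have hE₂ : ∀ e : (G.context A B).E, e.1 ∉ Set.range m₂.hom.onE := fun e he => e.2 (.inr he)
  choose s' hs₁ hs₂ using fun e : (G.context A B).E => key (G.src e.1)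
    (fun ⟨x, hx, he⟩ => (m₁.dangling _ (hE₁ e) x hx).1 he.symm)
    (fun ⟨x, hx, he⟩ => (m₂.dangling _ (hE₂ e) x hx).1 he.symm)
  choose t' ht₁ ht₂ using fun e : (G.context A B).E => key (G.tgt e.1)
    (fun ⟨x, hx, he⟩ => (m₁.dangling _ (hE₁ e) x hx).2 he.symm)
    (fun ⟨x, hx, he⟩ => (m₂.dangling _ (hE₂ e) x hx).2 he.symm)
  exact ⟨M.glue (G.context A B) s' t',
    m₁.nonempty_derivation_glue hs ht hr₁ hA₁ hB₁ (Iso.refl _) σ₁ hs₁ ht₁,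
    m₂.nonempty_derivation_glue hs ht hr₂ hA₂ hB₂ (Iso.refl _) σ₂ hs₂ ht₂⟩

end Main

end GraphTransformation

theorem mainTheorem5 {LV : Type v} {LE : Type w} [Finite LV] [Finite LE]
    (T : GraphTransformation.GTSystem.{u} LV LE)
    (D : Set (GraphTransformation.AbstractGraph.{u} LV LE))
    (h : ∀ (G H₁ H₂ : GraphTransformation.Graph.{u} LV LE)
      (d₁ : GraphTransformation.DirectDerivation T G H₁)
      (d₂ : GraphTransformation.DirectDerivation T G H₂),
      GraphTransformation.IsCriticalPair d₁ d₂ →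
      G.abs ∈ GraphTransformation.subgraphClosure D →
      GraphTransformation.StronglyJoinable d₁ d₂) :
    GraphTransformation.LocallyConfluentModuloGarbage T D := by
  rintro G H₁ H₂ hG ⟨⟨r₁, hr₁, m₁, φ₁⟩⟩ ⟨⟨r₂, hr₂, m₂, φ₂⟩⟩
  refine GraphTransformation.Joinable.of_iso φ₁.symm φ₂.symm ?_
  by_cases hi : m₁.Independent m₂
  · exact hi.joinable hr₁ hr₂
  by_cases heq : (⟨r₁, m₁⟩ : Σ r, GraphTransformation.Match r G) = ⟨r₂, m₂⟩
  · cases heq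
    exact ⟨_, ⟨.iso (.refl _)⟩, ⟨.iso (.refl _)⟩⟩
  · exact GraphTransformation.joinable_of_not_independent h hG hr₁ hr₂ m₁ m₂ hi heq
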